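/- A subset $C$ of the real projective plane $\mathbb{P}^2=\mathbb{P}^2(\mathbb{R})$ is called convex if its intersection with every projective line is connected (possibly empty), and properly convex if, moreover, its closure is contained in an affine open set, that is, in the complement of some projective line. Let $\Omega$ be a properly convex open subset of $\mathbb{P}^2$. Let $A$ be any affine open set containing $\overline{\Omega}$, equipped with any Euclidean norm $\|\cdot\|$. For $x\in\Omega$ and a vector $v\neq 0$ of $A$, let $p^+$ and $p^-$ be the points where the half-lines issuing from $x$ in the directions $v$ and $-v$ meet $\partial\Omega$, and put $$\|v\|_x=\Big(\frac{1}{\|x-p^-\|}+\frac{1}{\|x-p^+\|}\Big)\|v\|,\qquad \|0\|_x=0,\qquad B_x(1)=\{v : \|v\|_x<1\}.$$ Let $\mathrm{Vol}$ be the Lebesgue measure on $A$ normalized so that $\{v:\|v\|<1\}$ has measure $1$. The Busemann measure of $\Omega$ is the Borel measure $$\mu_\Omega(S)=\int_{S}\frac{d\mathrm{Vol}(x)}{\mathrm{Vol}(B_x(1))}\qquad (S\subseteq\Omega\ \text{Borel}),$$ extended to arbitrary subsets of $\Omega$ as an outer measure. Then for every point $s\in\partial\Omega$ and every neighbourhood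 $V$ of $s$ in $\overline{\Omega}$, one has $\mu_\Omega(V\cap\Omega)=\infty$. -/

import Mathlib

open MeasureTheory Topology
open scoped LinearAlgebra.Projectivization

noncomputable section

/-- The real projective plane. -/
abbrev RP2 : Type := ℙ ℝ (Fin 3 → ℝ)

/-- The Euclidean plane. -/
abbrev Plane : Type := EuclideanSpace ℝ (Fin 2)

/-- The usual topology of the projective plane: the quotient topology of `ℝ³ \ {0}`. -/
instance RP2.instTopologicalSpace : TopologicalSpace RP2 :=
  TopologicalSpace.coinduced (Projectivization.mk' ℝ : {v : Fin 3 → ℝ // v ≠ 0} → RP2)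
    inferInstance

instance RP2.instMeasurableSpace : MeasurableSpace RP2 := borel RP2

instance RP2.instBorelSpace : BorelSpace RP2 := ⟨rfl⟩

namespace RP2

/-- The set of points of the projective plane that lie in the linear subspace `W` of `ℝ³`.
It is a projective line when `W` has dimension two. -/
def subspacePoints (W : Submodule ℝ (Fin 3 → ℝ)) : Set RP2 :=
  {p | p.submodule ≤ W}

/-- A set of points is a (projective) line. -/
def IsLine (L : Set RP2) : Prop :=
  ∃ W : Submodule ℝ (Fin 3 → ℝ), Module.finrank ℝ W = 2 ∧ L = subspacePoints W

/-- An affine open set: the complement of a projective line. -/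
def IsAffineOpen (A : Set RP2) : Prop :=
  ∃ L : Set RP2, IsLine L ∧ A = Lᶜ

/-- A subset of the projective plane is convex if its intersection with every line is connected
(the empty intersection being allowed). -/
def IsConvex (C : Set RP2) : Prop :=
  ∀ L : Set RP2, IsLine L → IsPreconnected (C ∩ L)

/-- A convex set is properly convex if some affine open set contains its closure. -/
def IsProperlyConvex (C : Set RP2) : Prop :=
  IsConvex C ∧ ∃ A : Set RP2, IsAffineOpen A ∧ closure C ⊆ A

theorem vec_ne_zero (g : (Fin 3 → ℝ) ≃ₗ[ℝ] (Fin 3 → ℝ)) (x : Plane) :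
    g ![x 0, x 1, 1] ≠ 0 := by
  intro h
  have h0 : (![x 0, x 1, 1] : Fin 3 → ℝ) = 0 := g.map_eq_zero_iff.1 h
  simpa using congrFun h0 2

/-- The affine chart `(x₀, x₁) ↦ g [x₀ : x₁ : 1]`. When `g` runs over the linear automorphisms of
`ℝ³`, these are all the affine parametrizations of all the affine open sets by the Euclidean plane;
equivalently, all the choices of an affine open set together with a Euclidean norm on it. -/
def affineChart (g : (Fin 3 → ℝ) ≃ₗ[ℝ] (Fin 3 → ℝ)) (x : Plane) : RP2 :=
  Projectivization.mk ℝ (g ![x 0, x 1, 1]) (vec_ne_zero g x)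

theorem continuous_affineChart (g : (Fin 3 → ℝ) ≃ₗ[ℝ] (Fin 3 → ℝ)) :
    Continuous (affineChart g) := by
  have h1 : Continuous (Projectivization.mk' ℝ : {v : Fin 3 → ℝ // v ≠ 0} → RP2) :=
    continuous_coinduced_rng
  have hg : Continuous g := g.toLinearMap.continuous_of_finiteDimensional
  have h2 : Continuous fun x : Plane => (![x 0, x 1, 1] : Fin 3 → ℝ) := by
    refine continuous_pi fun i => ?_
    fin_cases i <;> simp <;> fun_prop
  exact h1.comp ((hg.comp h2).subtype_mk (vec_ne_zero g))

theorem measurable_affineChart (g : (Fin 3 → ℝ) ≃ₗ[ℝ] (Fin 3 → ℝ)) :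
    Measurable (affineChart g) :=
  (continuous_affineChart g).measurable

theorem mk_mem_subspacePoints (W : Submodule ℝ (Fin 3 → ℝ)) (v : Fin 3 → ℝ) (hv : v ≠ 0) :
    Projectivization.mk ℝ v hv ∈ subspacePoints W ↔ v ∈ W := by
  simp [subspacePoints, Submodule.span_singleton_le_iff_mem]

theorem range_affineChart (g : (Fin 3 → ℝ) ≃ₗ[ℝ] (Fin 3 → ℝ)) :
    Set.range (affineChart g) =
      (subspacePoints
        ((LinearMap.ker (LinearMap.proj 2 : (Fin 3 → ℝ) →ₗ[ℝ] ℝ)).map g.toLinearMap))ᶜ := by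
  ext p
  induction p using Projectivization.ind with | h v hv => ?_
  rw [Set.mem_compl_iff, mk_mem_subspacePoints, Set.mem_range]
  constructor
  · rintro ⟨x, hx⟩ ⟨w, hw, hgw⟩
    obtain ⟨a, ha⟩ := (Projectivization.mk_eq_mk_iff' ℝ _ _ _ _).1 hx
    rw [← hgw] at ha
    have : a • w = ![x 0, x 1, 1] := g.injective (by simpa using ha)
    have h2 := congrFun this 2
    have hw' : w 2 = 0 := hw
    simp [hw'] at h2
  · intro h
    set w := g.symm v with hw
    have hw2 : w 2 ≠ 0 := fun h2 => h ⟨w, h2, by simp [hw]⟩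
    refine ⟨!₂[w 0 / w 2, w 1 / w 2], ?_⟩
    refine (Projectivization.mk_eq_mk_iff' ℝ _ _ _ _).2 ⟨(w 2)⁻¹, ?_⟩
    apply g.symm.injective
    rw [map_smul, ← hw, g.symm_apply_apply]
    ext i
    fin_cases i <;> simp [hw2] <;> ring

/-- The affine open sets are exactly the images of the charts `affineChart g`. -/
theorem isAffineOpen_iff (A : Set RP2) :
    IsAffineOpen A ↔ ∃ g, A = Set.range (affineChart g) := by
  set K := LinearMap.ker (LinearMap.proj 2 : (Fin 3 → ℝ) →ₗ[ℝ] ℝ) with hK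
  have hKr : Module.finrank ℝ K = 2 := by
    have := (LinearMap.proj 2 : (Fin 3 → ℝ) →ₗ[ℝ] ℝ).finrank_range_add_finrank_ker
    have hs : Function.Surjective (LinearMap.proj 2 : (Fin 3 → ℝ) →ₗ[ℝ] ℝ) :=
      LinearMap.proj_surjective 2
    rw [LinearMap.range_eq_top.2 hs] at this
    simp at this
    rw [hK]
    omega
  constructor
  · rintro ⟨L, ⟨W, hW, rfl⟩, rfl⟩
    obtain ⟨K', hK'⟩ := K.exists_isCompl
    obtain ⟨W', hW'⟩ := W.exists_isCompl
    have e1 : K ≃ₗ[ℝ] W := LinearEquiv.ofFinrankEq _ _ (by omega)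
    have e2 : K' ≃ₗ[ℝ] W' := LinearEquiv.ofFinrankEq _ _ (by
      have a := Submodule.finrank_add_eq_of_isCompl hK'
      have b := Submodule.finrank_add_eq_of_isCompl hW'
      omega)
    let g : (Fin 3 → ℝ) ≃ₗ[ℝ] (Fin 3 → ℝ) :=
      (Submodule.prodEquivOfIsCompl K K' hK').symm ≪≫ₗ (e1.prodCongr e2) ≪≫ₗ
        Submodule.prodEquivOfIsCompl W W' hW'
    refine ⟨g, ?_⟩
    rw [range_affineChart g]
    congr 2
    symm
    apply Submodule.eq_of_le_of_finrank_eq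
    · rintro _ ⟨w, hw, rfl⟩
      have : (Submodule.prodEquivOfIsCompl K K' hK').symm w = ((⟨w, hw⟩ : K), 0) :=
        Submodule.prodEquivOfIsCompl_symm_apply_left _ _ hK' (⟨w, hw⟩ : K)
      simp [g, this]
    · exact (LinearEquiv.finrank_map_eq g K).trans (hKr.trans hW.symm)
  · rintro ⟨g, rfl⟩
    exact ⟨_, ⟨_, (LinearEquiv.finrank_map_eq g K).trans hKr, rfl⟩, range_affineChart g⟩

end RP2

namespace Hilbert

/-- The point at which the half-line issuing from `x` in the direction `v` meets the boundary
of `U` (there is exactly one when `U` is a bounded convex open set, `x ∈ U` and `v ≠ 0`). -/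
def exitPoint (U : Set Plane) (x v : Plane) : Plane :=
  x + sInf {t : ℝ | 0 < t ∧ x + t • v ∈ frontier U} • v

/-- The Finsler norm of the Hilbert metric of `U`:
`‖v‖ₓ = (1 / ‖x - p⁻‖ + 1 / ‖x - p⁺‖) ‖v‖`, where `p⁺` and `p⁻` are the points at which the
half-lines issuing from `x` in the directions `v` and `-v` meet the boundary of `U`. -/
def finslerNorm (U : Set Plane) (x v : Plane) : ℝ :=
  (1 / ‖x - exitPoint U x (-v)‖ + 1 / ‖x - exitPoint U x v‖) * ‖v‖

/-- The open unit ball of the Finsler norm at `x`. -/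
def finslerBall (U : Set Plane) (x : Plane) : Set Plane :=
  {v | finslerNorm U x v < 1}

/-- Lebesgue measure on the plane, normalized so that the Euclidean unit disc has measure one. -/
def vol : Measure Plane :=
  (volume (Metric.ball (0 : Plane) 1))⁻¹ • volume

/-- The Busemann measure of a bounded convex open set `U` of the Euclidean plane, carried by `U`:
`μ(S) = ∫_S dVol(x) / Vol(Bₓ(1))` for Borel `S ⊆ U`. -/
def planeBusemannMeasure (U : Set Plane) : Measure Plane :=
  (vol.restrict U).withDensity fun x => (vol (finslerBall U x))⁻¹

/-- The Busemann measure of a properly convex open set `Ω` of the projective plane, computed in the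
affine chart `affineChart g`, for a chart whose image contains the closure of `Ω`. -/
def busemannMeasure (g : (Fin 3 → ℝ) ≃ₗ[ℝ] (Fin 3 → ℝ)) (Ω : Set RP2) : Measure RP2 :=
  (planeBusemannMeasure (RP2.affineChart g ⁻¹' Ω)).map (RP2.affineChart g)

end Hilbert

end

/-!
In an affine chart, `Ω` becomes a bounded convex open subset `U` of the Euclidean plane: the chart is
an open embedding, the projective plane is compact, and the trace of `Ω` on each projective line is
connected. It remains to see that the density `1 / Vol(Bₓ(1))` is not integrable near a boundary
point `s` of `U`.

Fix `o ∈ U` and let `p` be the gauge of `U` with respect to `o`, so that `U = {p < 1}`. Let `x ∈ U`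
have gauge `l = p x`, and let `a` be the linear part of a supporting line of `U` at the radial
projection `q` of `x` to the boundary, normalized by `a (q - o) = 1`. If `v` belongs to the unit ball
of the Finsler norm at `x`, then both half-lines from `x` in the directions `±v` leave `U` after a
time larger than `1`; hence `|a v| ≤ 1 - l`, and `v` is bounded. Thus the unit ball lies in a slab of
thickness of order `1 - l` inside a fixed ball, and its volume is at most `C (1 - l)` with `C`
independent of `x` (`Hilbert.vol_finslerBall_le`).

On the other hand the part of the shell `l ≤ p < 1` which is seen from `o` in directions close to
that of `s` has volume at least `m (1 - l)` for some `m > 0`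
(`exists_ofReal_mul_le_conicalShell`). So all these shells have Busemann measure at least `m / C`.
As `l → 1` they decrease to the empty set while ending up in any given neighbourhood of `s`; by
continuity from above of measures, that neighbourhood cannot have finite measure
(`Hilbert.planeBusemannMeasure_eq_top_of_mem_nhds`).
-/

/-! ### Volume of thin slabs -/

/-- The linear map `v ↦ v + (δ - 1) a(v) q`, which has determinant `δ` when `a q = 1`, squeezes a
fixed ball onto a set containing the slab `|a| ≤ δ` of a smaller ball. -/
theorem measure_slab_inter_closedBall_le {E : Type*} [NormedAddCommGroup E] [NormedSpace ℝ E]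
    [FiniteDimensional ℝ E] [MeasurableSpace E] [BorelSpace E] (μ : Measure E)
    [μ.IsAddHaarMeasure] (a : StrongDual ℝ E) {q : E} {R M δ : ℝ} (haq : a q = 1) (hq : ‖q‖ ≤ R)
    (hδ : 0 < δ) (hδ1 : δ ≤ 1) :
    μ {v | |a v| ≤ δ ∧ ‖v‖ ≤ M} ≤ ENNReal.ofReal δ * μ (Metric.closedBall 0 (M + R)) := by
  set T : E →ₗ[ℝ] E := LinearMap.transvection (a : E →ₗ[ℝ] ℝ) ((δ - 1) • q) with hT
  have hdet : LinearMap.det T = δ := by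
    rw [hT, LinearMap.transvection.det]
    simp [haq]
  have hsub : {v | |a v| ≤ δ ∧ ‖v‖ ≤ M} ⊆ T '' Metric.closedBall 0 (M + R) := by
    rintro v ⟨h1, h2⟩
    refine ⟨v + ((1 / δ - 1) * a v) • q, ?_, ?_⟩
    · rw [mem_closedBall_zero_iff]
      refine (norm_add_le _ _).trans (add_le_add h2 ?_)
      rw [norm_smul, Real.norm_eq_abs, abs_mul]
      have h3 : 0 ≤ 1 / δ - 1 := by
        rw [sub_nonneg, le_div_iff₀ hδ]; linarith
      have h4 : |1 / δ - 1| * |a v| ≤ 1 := by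
        rw [abs_of_nonneg h3]
        calc (1 / δ - 1) * |a v| ≤ (1 / δ - 1) * δ := by gcongr
          _ = 1 - δ := by field_simp
          _ ≤ 1 := by linarith
      calc |1 / δ - 1| * |a v| * ‖q‖ ≤ 1 * ‖q‖ := by gcongr
        _ ≤ R := by linarith
    · simp only [hT, LinearMap.transvection.apply, map_add, map_smul, ContinuousLinearMap.coe_coe,
        haq]
      have : a v * (δ - 1) + (1 / δ - 1) * a v * (1 + (δ - 1)) = 0 := by
        field_simp; ring
      calc _ = v + (a v * (δ - 1) + (1 / δ - 1) * a v * (1 + (δ - 1))) • q := by module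
        _ = v := by rw [this, zero_smul, add_zero]
  calc μ {v | |a v| ≤ δ ∧ ‖v‖ ≤ M} ≤ μ (T '' Metric.closedBall 0 (M + R)) := measure_mono hsub
    _ = ENNReal.ofReal δ * μ (Metric.closedBall 0 (M + R)) := by
      rw [Measure.addHaar_image_linearMap, hdet, abs_of_pos hδ]

/-! ### Unit balls of the Finsler norm -/

namespace Hilbert

variable {U : Set Plane} {x v : Plane}

theorem exists_pos_add_smul_mem_frontier (ho : IsOpen U) (hb : Bornology.IsBounded U)
    (hx : x ∈ U) (hv : v ≠ 0) : ∃ t : ℝ, 0 < t ∧ x + t • v ∈ frontier U := by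
  obtain ⟨R, hR⟩ := hb.subset_closedBall x
  have hR0 : 0 ≤ R := by
    have := hR hx
    rwa [Metric.mem_closedBall, dist_self] at this
  have hv' : 0 < ‖v‖ := norm_pos_iff.2 hv
  set f : ℝ → Plane := fun t => x + t • v with hf
  have hfc : Continuous f := by fun_prop
  have hpre : IsPreconnected (f '' Set.Ici 0) := isPreconnected_Ici.image f hfc.continuousOn
  by_contra! hne
  -- A ray that avoids the frontier stays in `U`, which is bounded.
  have hsub : f '' Set.Ici 0 ⊆ U := by
    refine hpre.subset_left_of_subset_union ho isClosed_closure.isOpen_compl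
      (disjoint_compl_right.mono_left subset_closure) ?_ ⟨x, ⟨0, by simp, by simp [hf]⟩, hx⟩
    rintro _ ⟨t, ht, rfl⟩
    rcases (Set.mem_Ici.1 ht).eq_or_lt with rfl | ht
    · left
      simpa [hf] using hx
    · by_contra hc
      simp only [Set.mem_union, Set.mem_compl_iff, not_or, not_not] at hc
      exact hne t ht (by rw [ho.frontier_eq]; exact ⟨hc.2, hc.1⟩)
  have h := hR (hsub ⟨(R + 1) / ‖v‖, by simp; positivity, rfl⟩)
  have h1 : 0 < (R + 1) / ‖v‖ := by positivity
  rw [Metric.mem_closedBall, dist_eq_norm, hf, add_sub_cancel_left, norm_smul,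
    Real.norm_of_nonneg h1.le, div_mul_cancel₀ _ hv'.ne'] at h
  linarith

theorem exitPoint_spec (ho : IsOpen U) (hb : Bornology.IsBounded U) (hx : x ∈ U) (hv : v ≠ 0) :
    ∃ t : ℝ, 0 < t ∧ exitPoint U x v = x + t • v ∧ x + t • v ∈ frontier U := by
  set T : Set ℝ := {t : ℝ | 0 < t ∧ x + t • v ∈ frontier U} with hT
  have hxf : x ∉ frontier U := fun h => (ho.frontier_eq ▸ h).2 hx
  -- Since `x` is not on the frontier, the infimum may be taken over a closed set.
  have hT' : T = Set.Ici 0 ∩ (fun t : ℝ => x + t • v) ⁻¹' frontier U := by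
    ext t
    refine ⟨fun h => ⟨h.1.le, h.2⟩, fun h => ⟨lt_of_le_of_ne h.1 ?_, h.2⟩⟩
    rintro rfl
    exact hxf (by simpa using h.2)
  have hc : IsClosed T := by
    rw [hT']
    exact isClosed_Ici.inter (isClosed_frontier.preimage (by fun_prop))
  have h := hc.csInf_mem (exists_pos_add_smul_mem_frontier ho hb hx hv) ⟨0, fun t ht => ht.1.le⟩
  exact ⟨sInf T, h.1, rfl, h.2⟩

theorem finslerNorm_neg (U : Set Plane) (x v : Plane) :
    finslerNorm U x (-v) = finslerNorm U x v := by
  simp only [finslerNorm, neg_neg, norm_neg, add_comm]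

theorem exists_one_lt_of_mem_finslerBall (ho : IsOpen U) (hb : Bornology.IsBounded U)
    (hx : x ∈ U) (hv : v ≠ 0) (h : v ∈ finslerBall U x) :
    ∃ t : ℝ, 1 < t ∧ x + t • v ∈ frontier U := by
  obtain ⟨t, ht, he, hf⟩ := exitPoint_spec ho hb hx hv
  refine ⟨t, ?_, hf⟩
  have hv' : 0 < ‖v‖ := norm_pos_iff.2 hv
  have h' : (1 / ‖x - exitPoint U x (-v)‖ + 1 / ‖x - exitPoint U x v‖) * ‖v‖ < 1 := h
  have h1 : 1 / ‖x - exitPoint U x v‖ * ‖v‖ = 1 / t := by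
    rw [he, sub_add_cancel_left, norm_neg, norm_smul, Real.norm_of_nonneg ht.le]
    field_simp
  have h2 : 0 ≤ 1 / ‖x - exitPoint U x (-v)‖ * ‖v‖ := by positivity
  rw [add_mul, h1] at h'
  have h3 : 1 / t < 1 := by linarith
  rwa [div_lt_one ht] at h3

/-- The slab is cut out by a supporting line of `U` at `q`. -/
theorem exists_finslerBall_subset_slab (ho : IsOpen U) (hc : Convex ℝ U) {o q : Plane} {R l : ℝ}
    (hR : U ⊆ Metric.closedBall o R) (hoU : o ∈ U) (hq : q ∈ frontier U) (hl : l < 1)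
    (hx : o + l • (q - o) ∈ U) :
    ∃ a : StrongDual ℝ Plane, a (q - o) = 1 ∧
      finslerBall U (o + l • (q - o)) ⊆ {v | |a v| ≤ 1 - l ∧ ‖v‖ ≤ 2 * R} := by
  have hqU : q ∉ U := fun h => (ho.frontier_eq ▸ hq).2 h
  obtain ⟨f, hf⟩ := geometric_hahn_banach_open_point hc ho hqU
  have hfq : 0 < f (q - o) := by
    rw [map_sub, sub_pos]
    exact hf o hoU
  have hb : Bornology.IsBounded U := Metric.isBounded_closedBall.subset hR
  set a : StrongDual ℝ Plane := (f (q - o))⁻¹ • f with ha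
  have haq : a (q - o) = 1 := inv_mul_cancel₀ hfq.ne'
  refine ⟨a, haq, ?_⟩
  have hle : ∀ y ∈ closure U, a (y - o) ≤ 1 := by
    have hcl : IsClosed {y | a (y - o) ≤ 1} :=
      isClosed_le (by fun_prop) continuous_const
    refine fun y hy => closure_minimal (fun z hz => ?_) hcl hy
    have h1 : f (z - o) ≤ f (q - o) := by
      rw [map_sub, map_sub]
      linarith [hf z hz]
    change (f (q - o))⁻¹ * f (z - o) ≤ 1
    rw [inv_mul_le_iff₀ hfq]
    linarith
  have hRc : closure U ⊆ Metric.closedBall o R := closure_minimal hR Metric.isClosed_closedBall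
  set x := o + l • (q - o) with hxdef
  have hax : a (x - o) = l := by simp [hxdef, haq]
  have key : ∀ v ∈ finslerBall U x, a v ≤ 1 - l ∧ ‖v‖ ≤ 2 * R := by
    intro v hv
    have hR0 : 0 ≤ R := by
      have := hR hoU
      rwa [Metric.mem_closedBall, dist_self] at this
    rcases eq_or_ne v 0 with rfl | hv0
    · simp only [map_zero, norm_zero]
      constructor <;> linarith
    obtain ⟨t, ht, htf⟩ := exists_one_lt_of_mem_finslerBall ho hb hx hv0 hv
    have htc := frontier_subset_closure htf
    constructor
    · have h1 := hle _ htc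
      rw [show x + t • v - o = (x - o) + t • v by abel, map_add, hax, map_smul, smul_eq_mul] at h1
      by_contra! hcon
      nlinarith
    · have h1 : dist (x + t • v) x ≤ R + R := by
        refine (dist_triangle_right _ _ o).trans (add_le_add ?_ ?_)
        · exact hRc htc
        · exact hR hx
      rw [dist_eq_norm, add_sub_cancel_left, norm_smul, Real.norm_of_nonneg (by linarith)] at h1
      nlinarith [norm_nonneg v]
  intro v hv
  have hv' : -v ∈ finslerBall U x := by
    change finslerNorm U x (-v) < 1
    rw [finslerNorm_neg]
    exact hv
  refine ⟨abs_le.2 ⟨?_, (key v hv).1⟩, (key v hv).2⟩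
  have := (key _ hv').1
  rw [map_neg] at this
  linarith

instance isAddHaarMeasure_vol : vol.IsAddHaarMeasure :=
  Measure.IsAddHaarMeasure.smul _
    (ENNReal.inv_ne_zero.2 Metric.isBounded_ball.measure_lt_top.ne)
    (ENNReal.inv_ne_top.2 (Metric.measure_ball_pos _ _ one_pos).ne')

theorem vol_finslerBall_le (ho : IsOpen U) (hc : Convex ℝ U) {o q : Plane} {R l : ℝ}
    (hR : U ⊆ Metric.closedBall o R) (hoU : o ∈ U) (hq : q ∈ frontier U) (hl0 : 0 ≤ l)
    (hl : l < 1) (hx : o + l • (q - o) ∈ U) :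
    vol (finslerBall U (o + l • (q - o))) ≤
      ENNReal.ofReal (1 - l) * vol (Metric.closedBall 0 (2 * R + R)) := by
  obtain ⟨a, haq, ha⟩ := exists_finslerBall_subset_slab ho hc hR hoU hq hl hx
  refine (measure_mono ha).trans ?_
  refine measure_slab_inter_closedBall_le vol a haq ?_ (by linarith) (by linarith)
  rw [← dist_eq_norm]
  exact closure_minimal hR Metric.isClosed_closedBall (frontier_subset_closure hq)

end Hilbert

/-! ### Affine charts of the projective plane -/

namespace RP2

variable (g : (Fin 3 → ℝ) ≃ₗ[ℝ] (Fin 3 → ℝ))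

instance instCompactSpace : CompactSpace RP2 := by
  have h1 : Continuous (Projectivization.mk' ℝ : {v : Fin 3 → ℝ // v ≠ 0} → RP2) :=
    continuous_coinduced_rng
  have hne : ∀ u : Metric.sphere (0 : Fin 3 → ℝ) 1, (u : Fin 3 → ℝ) ≠ 0 := fun u =>
    ne_zero_of_mem_unit_sphere u
  have h2 : Continuous fun u : Metric.sphere (0 : Fin 3 → ℝ) 1 =>
      (Projectivization.mk' ℝ ⟨(u : Fin 3 → ℝ), hne u⟩ : RP2) :=
    h1.comp (continuous_subtype_val.subtype_mk hne)
  refine Function.Surjective.compactSpace (f := fun u : Metric.sphere (0 : Fin 3 → ℝ) 1 =>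
      (Projectivization.mk' ℝ ⟨(u : Fin 3 → ℝ), hne u⟩ : RP2)) h2 (fun p => ?_)
  induction p using Projectivization.ind with | h v hv => ?_
  refine ⟨⟨‖v‖⁻¹ • v, ?_⟩, ?_⟩
  · simp [norm_smul, hv]
  · exact (Projectivization.mk_eq_mk_iff' ℝ _ _ _ _).2 ⟨‖v‖⁻¹, rfl⟩

theorem affineChart_injective : Function.Injective (affineChart g) := by
  intro x y h
  obtain ⟨a, ha⟩ := (Projectivization.mk_eq_mk_iff' ℝ _ _ _ _).1 h
  rw [← map_smul] at ha
  have h3 := g.injective ha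
  have h2 := congrFun h3 2
  have ha1 : a = 1 := by simpa using h2
  have h0 := congrFun h3 0
  have h1 := congrFun h3 1
  ext i
  fin_cases i
  · simpa [ha1] using h0.symm
  · simpa [ha1] using h1.symm

theorem isOpenMap_affineChart : IsOpenMap (affineChart g) := by
  intro O hO
  rw [isOpen_coinduced]
  have hgs : Continuous g.symm := g.symm.toLinearMap.continuous_of_finiteDimensional
  set W : Set {v : Fin 3 → ℝ // v ≠ 0} := {v | g.symm v.1 2 ≠ 0} with hW
  have hc : ∀ i, Continuous fun v : {v : Fin 3 → ℝ // v ≠ 0} => g.symm v.1 i := fun i =>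
    (continuous_apply i).comp (hgs.comp continuous_subtype_val)
  have hWo : IsOpen W := isOpen_ne_fun (hc 2) continuous_const
  set k : {v : Fin 3 → ℝ // v ≠ 0} → Plane :=
    fun v => !₂[g.symm v.1 0 / g.symm v.1 2, g.symm v.1 1 / g.symm v.1 2] with hk
  have hkc : ContinuousOn k W := by
    refine (PiLp.continuous_toLp 2 _).comp_continuousOn (continuousOn_pi.2 fun i => ?_)
    fin_cases i
    · exact (hc 0).continuousOn.div (hc 2).continuousOn fun v hv => hv
    · exact (hc 1).continuousOn.div (hc 2).continuousOn fun v hv => hv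
  convert hkc.isOpen_inter_preimage hWo hO using 1
  ext ⟨v, hv⟩
  constructor
  · rintro ⟨x, hx, hxv⟩
    obtain ⟨a, ha⟩ := (Projectivization.mk_eq_mk_iff' ℝ _ _ _ _).1 hxv.symm
    have ha0 : a ≠ 0 := by
      rintro rfl
      exact hv (by simpa using ha.symm)
    have hgv : g.symm v = a • ![x 0, x 1, 1] := by
      rw [← ha, map_smul, g.symm_apply_apply]
    refine ⟨?_, ?_⟩
    · simp [hW, hgv, ha0]
    · have : k ⟨v, hv⟩ = x := by
        ext i
        fin_cases i <;> simp [hk, hgv, ha0]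
      rwa [Set.mem_preimage, this]
  · rintro ⟨h1, h2⟩
    refine ⟨k ⟨v, hv⟩, h2, ?_⟩
    have h1' : g.symm v 2 ≠ 0 := h1
    refine (Projectivization.mk_eq_mk_iff' ℝ _ _ _ _).2 ⟨(g.symm v 2)⁻¹, ?_⟩
    apply g.symm.injective
    rw [map_smul, g.symm_apply_apply]
    ext i
    fin_cases i <;> simp [hk, h1'] <;> ring

theorem isOpenEmbedding_affineChart : IsOpenEmbedding (affineChart g) :=
  .of_continuous_injective_isOpenMap (continuous_affineChart g) (affineChart_injective g)
    (isOpenMap_affineChart g)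

variable {g} {Ω : Set RP2}

theorem isBounded_preimage_affineChart (hg : closure Ω ⊆ Set.range (affineChart g)) :
    Bornology.IsBounded (affineChart g ⁻¹' Ω) := by
  have h : IsCompact (affineChart g ⁻¹' closure Ω) := by
    rw [(isOpenEmbedding_affineChart g).isInducing.isCompact_iff, Set.image_preimage_eq_of_subset hg]
    exact isClosed_closure.isCompact
  exact h.isBounded.subset (Set.preimage_mono subset_closure)

/-- The trace of a convex set on a line of the affine plane is preconnected, hence projects to an
interval of that line. -/
theorem IsConvex.convex_preimage_affineChart (hc : IsConvex Ω)
    (hg : Ω ⊆ Set.range (affineChart g)) : Convex ℝ (affineChart g ⁻¹' Ω) := by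
  rw [convex_iff_forall_pos]
  intro x hx y hy a b ha hb hab
  rcases eq_or_ne x y with rfl | hxy
  · rwa [← add_smul, hab, one_smul]
  set X : Plane → Fin 3 → ℝ := fun z => ![z 0, z 1, 1] with hX
  set W : Submodule ℝ (Fin 3 → ℝ) := Submodule.span ℝ {g (X x), g (X y)} with hW
  have hli : LinearIndependent ℝ ![g (X x), g (X y)] := by
    rw [LinearIndependent.pair_iff]
    intro s t hst
    rw [← map_smul, ← map_smul, ← map_add, g.map_eq_zero_iff] at hst
    have h0 := congrFun hst 0
    have h1 := congrFun hst 1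
    have h2 := congrFun hst 2
    simp [hX] at h0 h1 h2
    by_contra hne
    have hs : s ≠ 0 := by
      intro hs
      exact hne ⟨hs, by linarith⟩
    apply hxy
    have ht : t = -s := by linarith
    subst ht
    ext i
    fin_cases i
    · exact mul_left_cancel₀ hs (by simpa using (by linarith : s * x 0 = s * y 0))
    · exact mul_left_cancel₀ hs (by simpa using (by linarith : s * x 1 = s * y 1))
  have hfr : Module.finrank ℝ W = 2 := by
    have := finrank_span_eq_card hli
    rw [Matrix.range_cons_cons_empty] at this
    simpa [hW] using this
  have hmem : ∀ z, affineChart g z ∈ subspacePoints W →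
      ∃ t : ℝ, z = x + t • (y - x) := by
    intro z hz
    have hz' : g (X z) ∈ W := (mk_mem_subspacePoints W _ (vec_ne_zero g z)).1 hz
    obtain ⟨c, d, hcd⟩ := Submodule.mem_span_pair.1 hz'
    rw [← map_smul, ← map_smul, ← map_add] at hcd
    have h := g.injective hcd
    have h0 := congrFun h 0
    have h1 := congrFun h 1
    have h2 := congrFun h 2
    simp [hX] at h0 h1 h2
    refine ⟨d, ?_⟩
    have hc1 : c = 1 - d := by linarith
    subst hc1
    ext i
    fin_cases i
    · simp; linarith
    · simp; linarith
  have hpre : IsPreconnected (affineChart g ⁻¹' (Ω ∩ subspacePoints W)) :=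
    (hc _ ⟨W, hfr, rfl⟩).preimage_of_isOpenMap (affineChart_injective g)
      (isOpenMap_affineChart g) (Set.inter_subset_left.trans hg)
  have hφ : Continuous fun z : Plane => inner ℝ (y - x) (z - x) := by fun_prop
  have hI := (hpre.image _ hφ.continuousOn).ordConnected
  have hxW : affineChart g x ∈ subspacePoints W :=
    (mk_mem_subspacePoints W _ (vec_ne_zero g x)).2 (Submodule.subset_span (by simp [hX]))
  have hyW : affineChart g y ∈ subspacePoints W :=
    (mk_mem_subspacePoints W _ (vec_ne_zero g y)).2 (Submodule.subset_span (by simp [hX]))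
  have hn : 0 < ‖y - x‖ ^ 2 := by
    have : 0 < ‖y - x‖ := norm_pos_iff.2 (sub_ne_zero.2 hxy.symm)
    positivity
  obtain ⟨z, ⟨hzΩ, hzW⟩, hz⟩ := hI.out ⟨x, ⟨hx, hxW⟩, rfl⟩ ⟨y, ⟨hy, hyW⟩, rfl⟩
    (show b * ‖y - x‖ ^ 2 ∈ _ by
      constructor
      · simp; positivity
      · simp only [real_inner_self_eq_norm_sq]; nlinarith)
  obtain ⟨t, rfl⟩ := hmem z hzW
  have htb : t = b := by
    simp only [add_sub_cancel_left, inner_smul_right, real_inner_self_eq_norm_sq] at hz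
    exact mul_right_cancel₀ hn.ne' hz
  have : a • x + b • y = x + t • (y - x) := by
    rw [htb, eq_sub_of_add_eq hab]
    module
  rw [this]
  exact hzΩ

end RP2

/-! ### Conical shells -/

/-- The part of the level shell `l ≤ p < 1` seen in the directions close to `σ`: the points whose
radial projection `y / p(y)` to the level set `p = 1` is at distance less than `r` from `σ`. -/
def conicalShell (p : Plane → ℝ) (σ : Plane) (r l : ℝ) : Set Plane :=
  {y | l ≤ p y ∧ p y < 1 ∧ ‖(p y)⁻¹ • y - σ‖ < r}

section conicalShell

open scoped Pointwise

variable {p : Plane → ℝ} {σ y : Plane} {r l : ℝ}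

theorem measurableSet_conicalShell (hp : Continuous p) : MeasurableSet (conicalShell p σ r l) := by
  have hm := hp.measurable
  have hz : Measurable fun y => ‖(p y)⁻¹ • y - σ‖ :=
    ((hm.inv.smul measurable_id).sub_const σ).norm
  exact (measurableSet_le measurable_const hm).inter
    ((measurableSet_lt hm measurable_const).inter (measurableSet_lt hz measurable_const))

theorem conicalShell_anti {l' : ℝ} (h : l ≤ l') :
    conicalShell p σ r l' ⊆ conicalShell p σ r l :=
  fun _ hy => ⟨h.trans hy.1, hy.2⟩

theorem norm_sub_lt_of_mem_conicalShell (hl : 0 < l) (h : (1 - l) * (‖σ‖ + r) ≤ r)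
    (hy : y ∈ conicalShell p σ r l) : ‖y - σ‖ < 2 * r := by
  obtain ⟨h1, h2, h3⟩ := hy
  have hp : 0 < p y := hl.trans_le h1
  set z := (p y)⁻¹ • y with hz
  have hyz : y = p y • z := by rw [hz, smul_inv_smul₀ hp.ne']
  have hzn : ‖z‖ ≤ ‖σ‖ + r := by
    have := norm_add_le σ (z - σ)
    rw [add_sub_cancel] at this
    linarith
  have h4 : ‖y - z‖ ≤ r := by
    have : y - z = (p y - 1) • z := by rw [sub_smul, one_smul, ← hyz]
    rw [this, norm_smul, Real.norm_eq_abs, abs_sub_comm, abs_of_nonneg (by linarith)]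
    refine le_trans ?_ h
    gcongr
    linarith
  calc ‖y - σ‖ = ‖(y - z) + (z - σ)‖ := by rw [sub_add_sub_cancel]
    _ ≤ ‖y - z‖ + ‖z - σ‖ := norm_add_le _ _
    _ < 2 * r := by linarith

/-- The cone `⋃ l > 0, conicalShell p σ r l` is covered by the shell and by its own homothetic image
of ratio `l`, whose volume is `l ^ 2 ≤ l` times as large. Hence the volume of the shell is at least
proportional to its thickness `1 - l`. -/
theorem exists_ofReal_mul_le_conicalShell (μ : Measure Plane) [μ.IsAddHaarMeasure]
    (hp : Continuous p) (hph : ∀ t : ℝ, 0 < t → ∀ y, p (t • y) = t * p y)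
    (hb : Bornology.IsBounded {y | p y < 1}) (hσ : p σ = 1) (hr : 0 < r) :
    ∃ m : ENNReal, m ≠ 0 ∧
      ∀ l, 0 < l → l < 1 → ENNReal.ofReal (1 - l) * m ≤ μ (conicalShell p σ r l) := by
  set K : Set Plane := {y | (0 < p y ∧ p y < 1) ∧ ‖(p y)⁻¹ • y - σ‖ < r} with hK
  have hKo : IsOpen K := by
    have h1 : IsOpen {y | 0 < p y ∧ p y < 1} :=
      (isOpen_lt continuous_const hp).inter (isOpen_lt hp continuous_const)
    have h2 : ContinuousOn (fun y => ‖(p y)⁻¹ • y - σ‖) {y | 0 < p y ∧ p y < 1} :=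
      (((hp.continuousOn.inv₀ fun y hy => hy.1.ne').smul continuousOn_id).sub
        continuousOn_const).norm
    exact h2.isOpen_inter_preimage h1 isOpen_Iio
  have hKn : K.Nonempty := by
    refine ⟨(2 : ℝ)⁻¹ • σ, ?_⟩
    have : p ((2 : ℝ)⁻¹ • σ) = 2⁻¹ := by rw [hph _ (by norm_num), hσ, mul_one]
    refine ⟨by rw [this]; norm_num, ?_⟩
    rw [this, inv_smul_smul₀ (by norm_num), sub_self, norm_zero]
    exact hr
  have hKt : μ K ≠ ⊤ :=
    ((hb.subset fun y hy => hy.1.2).measure_lt_top).ne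
  refine ⟨μ K, (hKo.measure_pos μ hKn).ne', fun l hl0 hl1 => ?_⟩
  have hcov : K ⊆ conicalShell p σ r l ∪ l • K := by
    rintro y ⟨⟨h0, h1⟩, h2⟩
    rcases le_or_gt l (p y) with h | h
    · exact Or.inl ⟨h, h1, h2⟩
    · right
      rw [Set.mem_smul_set_iff_inv_smul_mem₀ hl0.ne']
      have hpl : p (l⁻¹ • y) = l⁻¹ * p y := hph _ (inv_pos.2 hl0) y
      refine ⟨⟨by rw [hpl]; positivity, ?_⟩, ?_⟩
      · rw [hpl, inv_mul_lt_iff₀ hl0]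
        linarith
      · rwa [hpl, mul_inv, inv_inv, smul_smul, mul_right_comm, mul_inv_cancel₀ hl0.ne', one_mul]
  have hsc : μ (l • K) ≤ ENNReal.ofReal l * μ K := by
    rw [Measure.addHaar_smul]
    gcongr
    rw [finrank_euclideanSpace_fin, abs_of_nonneg (by positivity)]
    nlinarith
  have hsum : ENNReal.ofReal (1 - l) * μ K + ENNReal.ofReal l * μ K ≤
      μ (conicalShell p σ r l) + ENNReal.ofReal l * μ K := by
    rw [← add_mul, ← ENNReal.ofReal_add (by linarith) hl0.le, sub_add_cancel, ENNReal.ofReal_one,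
      one_mul]
    calc μ K ≤ μ (conicalShell p σ r l) + μ (l • K) :=
          (measure_mono hcov).trans (measure_union_le _ _)
      _ ≤ _ := by gcongr
  exact (ENNReal.add_le_add_iff_right (ENNReal.mul_ne_top ENNReal.ofReal_ne_top hKt)).1 hsum

end conicalShell

/-! ### The Busemann measure near a boundary point -/

namespace Hilbert

/-- All shells `l ≤ p < 1` (with `p` the gauge of `U` at an interior point) have Busemann measure
bounded below by one positive constant near `s`, since the density is at least of order
`1 / (1 - l)` there, whereas they decrease to the empty set. -/
theorem planeBusemannMeasure_eq_top_of_mem_nhds {U : Set Plane} (ho : IsOpen U)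
    (hc : Convex ℝ U) (hb : Bornology.IsBounded U) {s : Plane} (hs : s ∈ frontier U)
    {O : Set Plane} (hO : O ∈ 𝓝 s) : planeBusemannMeasure U (O ∩ U) = ⊤ := by
  obtain ⟨o, hoU⟩ : U.Nonempty := closure_nonempty_iff.1 ⟨s, frontier_subset_closure hs⟩
  obtain ⟨R, hR⟩ := hb.subset_closedBall o
  set U₀ : Set Plane := (fun y => o + y) ⁻¹' U with hU₀
  have hU₀o : IsOpen U₀ := ho.preimage (by fun_prop)
  have hU₀c : Convex ℝ U₀ := hc.translate_preimage_right o
  have h0 : (0 : Plane) ∈ U₀ := by simpa [hU₀] using hoU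
  have hnhds : U₀ ∈ 𝓝 (0 : Plane) := hU₀o.mem_nhds h0
  have hU₀b : Bornology.IsBounded U₀ := by
    refine (Metric.isBounded_closedBall (x := (0 : Plane)) (r := R)).subset fun y hy => ?_
    have := hR hy
    rwa [Metric.mem_closedBall, dist_eq_norm, add_sub_cancel_left, ← mem_closedBall_zero_iff]
      at this
  have hfr : ∀ y, y ∈ frontier U₀ ↔ o + y ∈ frontier U := fun y => by
    have := (Homeomorph.addLeft o).preimage_frontier U
    exact (Set.ext_iff.1 this y).symm
  set p := gauge U₀ with hp
  have hpc : Continuous p := continuous_gauge hU₀c hnhds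
  have hplt : ∀ y, p y < 1 ↔ y ∈ U₀ := fun y => by
    rw [hp, gauge_lt_one_iff_mem_interior hU₀c hnhds, hU₀o.interior_eq]
  have hp1 : ∀ y, p y = 1 ↔ o + y ∈ frontier U := fun y => by
    rw [hp, gauge_eq_one_iff_mem_frontier hU₀c hnhds, hfr]
  have hph : ∀ t : ℝ, 0 < t → ∀ y, p (t • y) = t * p y := fun t ht y =>
    gauge_smul_of_nonneg ht.le y
  set σ := s - o with hσ
  have hpσ : p σ = 1 := by rw [hp1, hσ, add_sub_cancel]; exact hs
  obtain ⟨ε, hε, hεO⟩ := Metric.mem_nhds_iff.1 hO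
  set r := ε / 2 with hr
  have hr0 : 0 < r := by positivity
  obtain ⟨m, hm0, hm⟩ := exists_ofReal_mul_le_conicalShell vol hpc hph
    (hU₀b.subset fun y hy => (hplt y).1 hy) hpσ hr0
  set C := vol (Metric.closedBall (0 : Plane) (2 * R + R)) with hC
  have hCt : C ≠ ⊤ := Metric.isBounded_closedBall.measure_lt_top.ne
  set A : ℝ → Set Plane := fun l => (fun x => x - o) ⁻¹' conicalShell p σ r l with hA
  have hAm : ∀ l, MeasurableSet (A l) := fun l =>
    (measurableSet_conicalShell hpc).preimage (by fun_prop)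
  have hAU : ∀ l, A l ⊆ U := fun l x hx => by
    have := (hplt _).1 hx.2.1
    simpa [hU₀] using this
  have hνA : ∀ l, 0 < l → l < 1 → C⁻¹ * m ≤ planeBusemannMeasure U (A l) := by
    intro l hl0 hl1
    have hvol : vol (A l) = vol (conicalShell p σ r l) := by
      simp only [hA, sub_eq_add_neg]
      exact measure_preimage_add_right _ _ _
    have hdens : ∀ x ∈ A l,
        (ENNReal.ofReal (1 - l) * C)⁻¹ ≤ (vol (finslerBall U x))⁻¹ := by
      intro x hx
      rw [ENNReal.inv_le_inv]
      have hpx : 0 < p (x - o) := hl0.trans_le hx.1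
      have hq : p ((p (x - o))⁻¹ • (x - o)) = 1 := by
        rw [hph _ (inv_pos.2 hpx), inv_mul_cancel₀ hpx.ne']
      have hxq : x = o + p (x - o) • ((o + (p (x - o))⁻¹ • (x - o)) - o) := by
        rw [add_sub_cancel_left, smul_inv_smul₀ hpx.ne', add_sub_cancel]
      have h := vol_finslerBall_le (l := p (x - o)) ho hc hR hoU ((hp1 _).1 hq) hpx.le hx.2.1
        (by rw [← hxq]; exact hAU l hx)
      rw [← hxq] at h
      refine h.trans ?_
      gcongr
      exact hx.1
    have hδ0 : ENNReal.ofReal (1 - l) ≠ 0 := by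
      rw [Ne, ENNReal.ofReal_eq_zero, not_le]
      linarith
    rw [planeBusemannMeasure, withDensity_apply _ (hAm l), Measure.restrict_restrict (hAm l),
      Set.inter_eq_left.2 (hAU l)]
    calc C⁻¹ * m = (ENNReal.ofReal (1 - l) * C)⁻¹ * (ENNReal.ofReal (1 - l) * m) := by
          rw [ENNReal.mul_inv (Or.inl hδ0) (Or.inl ENNReal.ofReal_ne_top), mul_mul_mul_comm,
            ENNReal.inv_mul_cancel hδ0 ENNReal.ofReal_ne_top, one_mul]
      _ ≤ (ENNReal.ofReal (1 - l) * C)⁻¹ * vol (A l) := by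
          rw [hvol]
          gcongr
          exact hm l hl0 hl1
      _ = ∫⁻ _ in A l, (ENNReal.ofReal (1 - l) * C)⁻¹ ∂vol := by rw [setLIntegral_const]
      _ ≤ ∫⁻ x in A l, (vol (finslerBall U x))⁻¹ ∂vol := setLIntegral_mono' (hAm l) hdens
  by_contra hfin
  -- With this thickness the shells lie in the ball of radius `2 * r` around `s`.
  set δ := r / (‖σ‖ + 2 * r) with hδ
  have hδ0 : 0 < δ := by positivity
  have hδ1 : δ < 1 := by
    rw [hδ, div_lt_one (by positivity)]
    linarith [norm_nonneg σ]
  set l : ℕ → ℝ := fun n => 1 - δ / (n + 1) with hl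
  have hl1 : ∀ n, l n < 1 := fun n => by
    have : 0 < δ / ((n : ℝ) + 1) := by positivity
    simp only [hl]
    linarith
  have hlδ : ∀ n, 1 - δ ≤ l n := fun n => by
    have : δ / ((n : ℝ) + 1) ≤ δ := div_le_self hδ0.le (by linarith [n.cast_nonneg (α := ℝ)])
    simp only [hl]
    linarith
  have hl0 : ∀ n, 0 < l n := fun n => lt_of_lt_of_le (by linarith) (hlδ n)
  have hlmono : Monotone l := fun i j hij => by
    simp only [hl]
    gcongr
  have hltend : Filter.Tendsto l Filter.atTop (𝓝 1) := by
    have := (tendsto_const_div_atTop_nhds_zero_nat δ).comp (Filter.tendsto_add_atTop_nat 1)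
    simpa [hl, Function.comp_def] using this.const_sub 1
  have hAO : A (l 0) ⊆ O ∩ U := by
    refine fun x hx => ⟨hεO ?_, hAU _ hx⟩
    have h1 : (1 - l 0) * (‖σ‖ + r) ≤ r := by
      have h2 : 1 - l 0 = δ := by simp [hl]
      rw [h2, hδ, div_mul_eq_mul_div, div_le_iff₀ (by positivity)]
      nlinarith [norm_nonneg σ]
    have h3 := norm_sub_lt_of_mem_conicalShell (hl0 0) h1 hx
    rw [Metric.mem_ball, dist_eq_norm]
    rw [hσ, sub_sub_sub_cancel_right] at h3
    linarith
  have hanti : Antitone fun n => A (l n) := fun i j hij =>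
    Set.preimage_mono (conicalShell_anti (hlmono hij))
  have hempty : ⋂ n, A (l n) = ∅ := by
    rw [Set.eq_empty_iff_forall_notMem]
    intro x hx
    rw [Set.mem_iInter] at hx
    exact absurd (le_of_tendsto' hltend fun n => (hx n).1) (hx 0).2.1.not_ge
  have hlim := tendsto_measure_iInter_atTop (μ := planeBusemannMeasure U)
    (fun n => (hAm (l n)).nullMeasurableSet) hanti ⟨0, ne_top_of_le_ne_top hfin (measure_mono hAO)⟩
  rw [hempty, measure_empty] at hlim
  have hle : C⁻¹ * m ≤ 0 := ge_of_tendsto' hlim fun n => hνA _ (hl0 n) (hl1 n)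
  exact mul_ne_zero (ENNReal.inv_ne_zero.2 hCt) hm0 (le_zero_iff.1 hle)

end Hilbert

/-! ### Divergence at every boundary point -/

theorem mainTheorem11 (Ω : Set RP2) (hopen : IsOpen Ω) (hconv : RP2.IsProperlyConvex Ω)
    (g : (Fin 3 → ℝ) ≃ₗ[ℝ] (Fin 3 → ℝ)) (hg : closure Ω ⊆ Set.range (RP2.affineChart g))
    (s : RP2) (hs : s ∈ frontier Ω) (V : Set RP2) (hV : V ∈ 𝓝[closure Ω] s) :
    Hilbert.busemannMeasure g Ω (V ∩ Ω) = ⊤ := by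
  obtain ⟨W, hWo, hsW, hWV⟩ := mem_nhdsWithin.1 hV
  obtain ⟨s', rfl⟩ := hg (frontier_subset_closure hs)
  have hcont := RP2.continuous_affineChart g
  have hs' : s' ∈ frontier (RP2.affineChart g ⁻¹' Ω) := by
    rw [← (RP2.isOpenMap_affineChart g).preimage_frontier_eq_frontier_preimage hcont]
    exact hs
  have hsub : W ∩ Ω ⊆ V ∩ Ω := fun x hx => ⟨hWV ⟨hx.1, subset_closure hx.2⟩, hx.2⟩
  rw [eq_top_iff]
  calc ⊤ = Hilbert.planeBusemannMeasure (RP2.affineChart g ⁻¹' Ω)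
        (RP2.affineChart g ⁻¹' W ∩ RP2.affineChart g ⁻¹' Ω) :=
        (Hilbert.planeBusemannMeasure_eq_top_of_mem_nhds (hopen.preimage hcont)
          (hconv.1.convex_preimage_affineChart (subset_closure.trans hg))
          (RP2.isBounded_preimage_affineChart hg) hs'
          ((hWo.preimage hcont).mem_nhds hsW)).symm
    _ = Hilbert.busemannMeasure g Ω (W ∩ Ω) :=
        (Measure.map_apply (RP2.measurable_affineChart g) (hWo.inter hopen).measurableSet).symm
    _ ≤ Hilbert.busemannMeasure g Ω (V ∩ Ω) := measure_mono hsub
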